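/- Theorem. Let $E\subseteq\mathbb R^D$ be a Borel set and let $\mu,\nu$ be probability distributions on $E$ with probability densities $f_\mu,f_\nu$ with respect to Lebesgue measure on $E$. Write $S_\mu,S_\nu$ for the (topological) supports. Assume that $f_\mu$ and $f_\nu$ are uniformly continuous on $E\cap S_\mu$ and $E\cap S_\nu$ respectively, and that there are constants $a_1>0$, $a_2>0$ with $a_1<f_\mu(x)\le a_2$ for all $x\in E\cap S_\mu$ and $a_1<f_\nu(x)\le a_2$ for all $x\in E\cap S_\nu$. (This holds in particular if both densities are uniformly continuous on $E$ with values in $(a_1,a_2]$ on all of $E$.) For each $n$ let $D_X=(x_1,\dots,x_n)\sim\mu^{\otimes n}$ and $D_Y=(y_1,\dots,y_n)\sim\nu^{\otimes n}$ be independent samples. For a point $y$ of $D_Y$ let $y_{(k)}$ be its $k$-th nearest neighbour, in Euclidean distance, among the other points of $D_Y$, and similarly $x_{(k)}$ for a point $x$ of $D_X$. The improved precision $\alpha^n_k$ is the fraction of the $x\in D_X$ for which there is $y\in D_Y$ with $\|x-y\|\le\|y_{(k)}-y\|$; the improved recall $\beta^n_k$ is the fraction of the $y\in D_Y$ for which there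 is $x\in D_X$ with $\|y-x\|\le\|x_{(k)}-x\|$. For $\alpha,\beta\in(0,1]$, $\mu$ has attainable precision $\alpha$ at recall $\beta$ with respect to $\nu$ if there are probability distributions $\kappa,\mu',\nu'$ with $\nu=\beta\kappa+(1-\beta)\nu'$ and $\mu=\alpha\kappa+(1-\alpha)\mu'$; the pair $(0,0)$ also counts as attainable. Let $\bar\alpha$ and $\bar\beta$ be the maximal attainable precision and the maximal attainable recall. Let $k=k(n)$ be positive integers with $k/\log n\to\infty$ and $k/n\to0$ as $n\to\infty$. Then the maxima $\bar\alpha,\bar\beta$ exist, $\bar\alpha=\mu(S_\nu)$, $\bar\beta=\nu(S_\mu)$, and, as $n\to\infty$, $$\alpha^n_k\to\bar\alpha\quad\text{in probability},\qquad \beta^n_k\to\bar\beta\quad\text{in probability}.$$ -/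

import Mathlib

open MeasureTheory ProbabilityTheory Filter Topology

noncomputable section

namespace ImprovedPR

/-- `f` is a probability density of `μ` on the set `E` with respect to Lebesgue measure:
`μ` is carried by `E` and `μ(dx) = f(x) dx` there. Only the values of `f` on `E` matter. -/
structure HasDensityOn {d : ℕ} (μ : Measure (EuclideanSpace ℝ (Fin d)))
    (f : EuclideanSpace ℝ (Fin d) → ℝ) (E : Set (EuclideanSpace ℝ (Fin d))) : Prop where
  aemeasurable : AEMeasurable f (volume.restrict E)
  nonneg : ∀ x ∈ E, 0 ≤ f x
  eq_withDensity : μ = (volume.restrict E).withDensity (fun x => ENNReal.ofReal (f x))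

/-- For `α, β ∈ (0, 1]`, the distribution `μ` has attainable precision `α` at recall `β`
with respect to `ν`: there are probability distributions `κ`, `μ'`, `ν'` such that
`ν = β κ + (1 - β) ν'` and `μ = α κ + (1 - α) μ'`. -/
def IsAttainable {V : Type*} [MeasurableSpace V] (μ ν : Measure V) (α β : ℝ) : Prop :=
  (0 < α ∧ α ≤ 1) ∧ (0 < β ∧ β ≤ 1) ∧
    ∃ κ μ' ν' : Measure V,
      IsProbabilityMeasure κ ∧ IsProbabilityMeasure μ' ∧ IsProbabilityMeasure ν' ∧
      ν = ENNReal.ofReal β • κ + ENNReal.ofReal (1 - β) • ν' ∧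
      μ = ENNReal.ofReal α • κ + ENNReal.ofReal (1 - α) • μ'

/-- The precision-recall set of `μ` with respect to `ν`: all attainable pairs
`(precision, recall)`, together with the trivial pair `(0, 0)`. -/
def prSet {V : Type*} [MeasurableSpace V] (μ ν : Measure V) : Set (ℝ × ℝ) :=
  {p | IsAttainable μ ν p.1 p.2} ∪ {(0, 0)}

/-- The maximal attainable precision of `μ` with respect to `ν` is `a`. -/
def IsMaxPrecision {V : Type*} [MeasurableSpace V] (μ ν : Measure V) (a : ℝ) : Prop :=
  IsGreatest (Prod.fst '' prSet μ ν) a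

/-- The maximal attainable recall of `μ` with respect to `ν` is `b`. -/
def IsMaxRecall {V : Type*} [MeasurableSpace V] (μ ν : Measure V) (b : ℝ) : Prop :=
  IsGreatest (Prod.snd '' prSet μ ν) b

/-- The number of data points, other than the `j`-th one, at distance at most `r`
from the `j`-th one. -/
def neighborCount {V : Type*} [PseudoMetricSpace V] {n : ℕ} (y : Fin n → V) (j : Fin n)
    (r : ℝ) : ℕ :=
  Set.ncard {i : Fin n | i ≠ j ∧ dist (y i) (y j) ≤ r}

/-- The distance from the data point `y j` to its `k`-th nearest neighbour among the other
data points (the `k`-th smallest of the distances `dist (y i) (y j)`, `i ≠ j`, ties counted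
with multiplicity). It is meant for `1 ≤ k ≤ n - 1`. -/
def kthNeighborDist {V : Type*} [PseudoMetricSpace V] {n : ℕ} (y : Fin n → V) (k : ℕ)
    (j : Fin n) : ℝ :=
  sInf {r : ℝ | 0 ≤ r ∧ k ≤ neighborCount y j r}

/-- The defining property of the `k`-th smallest distance. -/
theorem kthNeighborDist_le_iff {V : Type*} [PseudoMetricSpace V] {n : ℕ} (y : Fin n → V)
    {k : ℕ} (hk : k + 1 ≤ n) (j : Fin n) {r : ℝ} (hr : 0 ≤ r) :
    kthNeighborDist y k j ≤ r ↔ k ≤ neighborCount y j r := by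
  have hbdd : BddBelow {r : ℝ | 0 ≤ r ∧ k ≤ neighborCount y j r} := ⟨0, fun r h => h.1⟩
  constructor
  · intro h
    by_contra hlt
    have hfin : {i : Fin n | r < dist (y i) (y j)}.Finite := Set.toFinite _
    obtain ⟨R, hR1, hR2⟩ : ∃ R, r < R ∧ ∀ i, r < dist (y i) (y j) → R ≤ dist (y i) (y j) := by
      rcases Set.eq_empty_or_nonempty {i : Fin n | r < dist (y i) (y j)} with he | hne
      · refine ⟨r + 1, by linarith, fun i hi => ?_⟩
        have : i ∈ {i : Fin n | r < dist (y i) (y j)} := hi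
        simp [he] at this
      · obtain ⟨i, hi, hmin⟩ := Set.exists_min_image _ (fun i => dist (y i) (y j)) hfin hne
        exact ⟨_, hi, fun i' hi' => hmin i' hi'⟩
    have hne : {r : ℝ | 0 ≤ r ∧ k ≤ neighborCount y j r}.Nonempty := by
      refine ⟨∑ i, dist (y i) (y j), Finset.sum_nonneg fun i _ => dist_nonneg, ?_⟩
      have : {i : Fin n | i ≠ j ∧ dist (y i) (y j) ≤ ∑ i, dist (y i) (y j)} = {j}ᶜ := by
        ext i
        simp only [ne_eq, Set.mem_ofPred_eq, Set.mem_compl_iff, Set.mem_singleton_iff,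
          and_iff_left_iff_imp]
        exact fun _ => Finset.single_le_sum (f := fun i => dist (y i) (y j))
          (fun i _ => dist_nonneg) (Finset.mem_univ i)
      rw [neighborCount, this, Set.ncard_compl, Set.ncard_singleton, Nat.card_eq_fintype_card,
        Fintype.card_fin]
      omega
    obtain ⟨s, ⟨hs0, hs⟩, hsR⟩ := exists_lt_of_csInf_lt hne (lt_of_le_of_lt h hR1)
    apply hlt
    refine hs.trans (Set.ncard_le_ncard (fun i hi => ⟨hi.1, ?_⟩) (Set.toFinite _))
    by_contra hi'
    have := hR2 i (not_le.mp hi')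
    linarith [hi.2]
  · intro h
    exact csInf_le hbdd ⟨hr, h⟩

open Classical in
/-- The improved precision of the data set `x` with respect to the data set `y`: the fraction
of the points `x i` that satisfy `‖x i - y j‖ ≤ ‖y_(k) - y j‖` for some `j`, where `y_(k)` is
the `k`-th nearest neighbour of `y j` among the other points of `y`. -/
def improvedPrecision {V : Type*} [PseudoMetricSpace V] {n : ℕ} (k : ℕ) (x y : Fin n → V) : ℝ :=
  (1 / (n : ℝ)) * ∑ i, if ∃ j, dist (x i) (y j) ≤ kthNeighborDist y k j then 1 else 0

/-- The improved recall of the data set `x` with respect to the data set `y`: the fraction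
of the points `y j` that satisfy `‖y j - x i‖ ≤ ‖x_(k) - x i‖` for some `i`. -/
def improvedRecall {V : Type*} [PseudoMetricSpace V] {n : ℕ} (k : ℕ) (x y : Fin n → V) : ℝ :=
  improvedPrecision k y x

end ImprovedPR

end

noncomputable section

namespace ImprovedPR

/-! ### Counting sample points -/

section Counting

variable {V : Type*}

/-! Improved precision is the fraction of the `x i` that are covered by the k-nearest-neighbour
balls of an independent sample `y`. By Fubini and Markov (`tendstoInMeasure_improvedPrecision`) it
suffices that, for almost every fixed `x`, the probability of being covered tends to 1 on the
support of `ν` and to 0 off it; the fraction of the `x i` in the support is then handled by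
Chebyshev.

Off the support, every ball centred at a typical data point with `x` on its boundary contains one of
finitely many sets of positive mass. Coverage would leave at most `k` points in one of them, against
a mean of order `n`, and `k / n → 0`. On the support, differentiation of measures gives balls around
`x` of mass comparable to `r ^ d`. At a suitable scale the ball of radius `r` is expected to contain
order `k` points and the ball of radius `2r` at most `k / 2`, which forces coverage.

The maximal precision is measure-theoretic: a common part `κ` lives on the support of `ν`, so no
precision exceeds the `μ`-mass of that support. The normalised restriction of `μ` attains it,
because the density bounds dominate that restriction by a multiple of `ν`. -/

theorem ncard_eq_sum_indicator {n : ℕ} (A : Set V) (y : Fin n → V) :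
    (Set.ncard {i | y i ∈ A} : ℝ) = ∑ i, A.indicator (fun _ => (1 : ℝ)) (y i) := by
  classical
  rw [Set.ncard_eq_toFinset_card']
  simp [Set.indicator, Finset.sum_boole]

variable [MeasurableSpace V]

theorem measurable_ncard_mem {n : ℕ} {A : Set V} (hA : MeasurableSet A) :
    Measurable fun y : Fin n → V => (Set.ncard {i | y i ∈ A} : ℝ) := by
  simp_rw [ncard_eq_sum_indicator]
  exact Finset.measurable_sum _ fun i _ =>
    (measurable_const.indicator hA).comp (measurable_pi_apply i)

/-- Chebyshev's inequality for the number of sample points in a set. -/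
theorem pi_le_abs_ncard_sub (ν : Measure V) [IsProbabilityMeasure ν] (n : ℕ) {A : Set V}
    (hA : MeasurableSet A) {t : ℝ} (ht : 0 < t) :
    (Measure.pi fun _ : Fin n => ν) {y | t ≤ |(Set.ncard {i | y i ∈ A} : ℝ) - n * ν.real A|} ≤
      ENNReal.ofReal (n * ν.real A / t ^ 2) := by
  set I : V → ℝ := A.indicator fun _ => (1 : ℝ) with hI
  have hImem : MemLp I 2 ν := memLp_indicator_const 2 hA 1 (Or.inr (measure_ne_top _ _))
  have hmem : ∀ i : Fin n, MemLp (fun y : Fin n → V => I (y i)) 2 (Measure.pi fun _ => ν) :=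
    fun i => hImem.comp_measurePreserving (measurePreserving_eval (fun _ : Fin n => ν) i)
  have hsum : MemLp (∑ i : Fin n, fun y : Fin n → V => I (y i)) 2 (Measure.pi fun _ => ν) :=
    memLp_finsetSum' _ fun i _ => hmem i
  have hmean : (∫ y, (∑ i : Fin n, fun y : Fin n → V => I (y i)) y ∂(Measure.pi fun _ => ν)) =
      n * ν.real A := by
    simp only [Finset.sum_apply]
    rw [integral_finsetSum _ fun i _ => (hmem i).integrable (by norm_num)]
    have : ∀ i : Fin n, (∫ y : Fin n → V, I (y i) ∂(Measure.pi fun _ => ν)) = ν.real A := by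
      intro i
      have := integral_comp_eval (μ := fun _ : Fin n => ν) (i := i) (f := I)
        hImem.aestronglyMeasurable
      rw [this, hI, integral_indicator_const _ hA]
      simp
    simp [this]
  have hvar : Var[∑ i : Fin n, fun y : Fin n → V => I (y i); Measure.pi fun _ => ν] ≤
      n * ν.real A := by
    rw [variance_sum_pi (μ := fun _ : Fin n => ν) (X := fun _ => I) fun _ => hImem]
    have : Var[I; ν] ≤ ν.real A := by
      refine (variance_le_expectation_sq hImem.aestronglyMeasurable).trans (le_of_eq ?_)
      have : I ^ 2 = I := by
        ext x
        by_cases hx : x ∈ A <;> simp [hI, hx]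
      rw [this, hI, integral_indicator_const _ hA]
      simp
    simpa using mul_le_mul_of_nonneg_left this (Nat.cast_nonneg n)
  have := meas_ge_le_variance_div_sq hsum ht
  rw [hmean] at this
  simp only [Finset.sum_apply] at this
  simp_rw [ncard_eq_sum_indicator]
  refine this.trans (ENNReal.ofReal_le_ofReal ?_)
  gcongr

theorem pi_ncard_le_half (ν : Measure V) [IsProbabilityMeasure ν] (n : ℕ) {A : Set V}
    (hA : MeasurableSet A) (hpos : 0 < n * ν.real A) :
    (Measure.pi fun _ : Fin n => ν) {y | (Set.ncard {i | y i ∈ A} : ℝ) ≤ n * ν.real A / 2} ≤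
      ENNReal.ofReal (4 / (n * ν.real A)) := by
  refine (measure_mono fun y hy => ?_).trans
    ((pi_le_abs_ncard_sub ν n hA (half_pos hpos)).trans_eq ?_)
  · simp only [Set.mem_ofPred_eq] at hy ⊢
    rw [abs_sub_comm]
    exact le_trans (by linarith) (le_abs_self _)
  · congr 1
    field_simp
    norm_num

theorem pi_le_ncard (ν : Measure V) [IsProbabilityMeasure ν] (n : ℕ) {A : Set V}
    (hA : MeasurableSet A) {k : ℝ} (hk : 0 < k) (hle : n * ν.real A ≤ k / 2) :
    (Measure.pi fun _ : Fin n => ν) {y | k ≤ (Set.ncard {i | y i ∈ A} : ℝ)} ≤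
      ENNReal.ofReal (2 / k) := by
  refine (measure_mono fun y hy => ?_).trans
    ((pi_le_abs_ncard_sub ν n hA (half_pos hk)).trans (ENNReal.ofReal_le_ofReal ?_))
  · simp only [Set.mem_ofPred_eq] at hy ⊢
    exact le_trans (by linarith) (le_abs_self _)
  · rw [div_le_div_iff₀ (by positivity) hk]
    nlinarith

end Counting

/-! ### Covered points -/

section Covered

variable {V : Type*} [PseudoMetricSpace V] {n : ℕ}

/-- `x` lies in one of the `k`-nearest-neighbour balls of the data set `y`. -/
def IsCovered (k : ℕ) (x : V) (y : Fin n → V) : Prop :=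
  ∃ j, dist x (y j) ≤ kthNeighborDist y k j

theorem kthNeighborDist_nonneg (y : Fin n → V) (k : ℕ) (j : Fin n) : 0 ≤ kthNeighborDist y k j :=
  Real.sInf_nonneg fun _ h => h.1

/-- Replaces the infimum by a strict count, which makes coverage a counting condition: it can be
tested for measurability and compared with sample counts. -/
theorem le_kthNeighborDist_iff (y : Fin n → V) {k : ℕ} (hk1 : 1 ≤ k) (hk : k + 1 ≤ n)
    (j : Fin n) (s : ℝ) :
    s ≤ kthNeighborDist y k j ↔ Set.ncard {i | i ≠ j ∧ dist (y i) (y j) < s} < k := by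
  rw [← not_iff_not, not_le, not_lt]
  constructor
  · intro h
    have := (kthNeighborDist_le_iff y hk j (kthNeighborDist_nonneg y k j)).1 le_rfl
    exact this.trans (Set.ncard_le_ncard (fun i hi => ⟨hi.1, hi.2.trans_lt h⟩) (Set.toFinite _))
  · intro h
    have hne : {i | i ≠ j ∧ dist (y i) (y j) < s}.Nonempty := by
      rw [← Set.ncard_pos (Set.toFinite _)]
      omega
    -- The farthest of the finitely many points strictly within `s` gives a radius below `s` that
    -- already counts all of them.
    obtain ⟨m, hm, hmax⟩ := Set.exists_max_image _ (fun i => dist (y i) (y j))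
      (Set.toFinite _) hne
    refine lt_of_le_of_lt ((kthNeighborDist_le_iff y hk j (dist_nonneg (x := y m))).2 ?_) hm.2
    exact h.trans (Set.ncard_le_ncard (fun i hi => ⟨hi.1, hmax i hi⟩) (Set.toFinite _))

theorem isCovered_iff {k : ℕ} (hk1 : 1 ≤ k) (hk : k + 1 ≤ n) (x : V) (y : Fin n → V) :
    IsCovered k x y ↔ ∃ j, Set.ncard {i | i ≠ j ∧ dist (y i) (y j) < dist x (y j)} < k := by
  simp only [IsCovered, le_kthNeighborDist_iff y hk1 hk]

theorem measurableSet_isCovered [MeasurableSpace V] [OpensMeasurableSpace V]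
    [SecondCountableTopology V] {k : ℕ} (hk1 : 1 ≤ k) (hk : k + 1 ≤ n) :
    MeasurableSet {p : V × (Fin n → V) | IsCovered k p.1 p.2} := by
  classical
  simp only [isCovered_iff hk1 hk, Set.ofPred_exists]
  refine MeasurableSet.iUnion fun j => ?_
  have : Measurable fun p : V × (Fin n → V) =>
      Set.ncard {i | i ≠ j ∧ dist (p.2 i) (p.2 j) < dist p.1 (p.2 j)} := by
    simp_rw [Set.ncard_eq_toFinset_card', Set.toFinset_ofPred, Finset.card_filter]
    refine Finset.measurable_sum _ fun i _ => Measurable.ite ?_ measurable_const measurable_const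
    by_cases hij : i = j
    · simp [hij]
    · simp only [ne_eq, hij, not_false_eq_true, true_and]
      exact measurableSet_lt (by fun_prop) (by fun_prop)
  exact this (measurableSet_Iio (a := k))

/-- A covered point whose distance ball around every data point contains one of the sets `A`
forces one of these sets to contain few data points. -/
theorem exists_ncard_le_of_isCovered {k : ℕ} (hk1 : 1 ≤ k) (hk : k + 1 ≤ n) {x : V}
    {y : Fin n → V} (h : IsCovered k x y) {T : Set (Set V)}
    (hT : ∀ j, ∃ A ∈ T, A ⊆ Metric.ball (y j) (dist x (y j))) :
    ∃ A ∈ T, Set.ncard {i | y i ∈ A} ≤ k := by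
  obtain ⟨j, hj⟩ := (isCovered_iff hk1 hk x y).1 h
  obtain ⟨A, hA, hsub⟩ := hT j
  refine ⟨A, hA, ?_⟩
  -- The centre may lie in `A` but is not its own neighbour, so `< k` weakens to `≤ k`.
  have : {i | y i ∈ A} ⊆ insert j {i | i ≠ j ∧ dist (y i) (y j) < dist x (y j)} := by
    intro i hi
    by_cases hij : i = j
    · exact Or.inl hij
    · exact Or.inr ⟨hij, hsub hi⟩
  have h1 := Set.ncard_le_ncard this (Set.toFinite _)
  have h2 := Set.ncard_insert_le j {i | i ≠ j ∧ dist (y i) (y j) < dist x (y j)}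
  omega

/-- If some data point is close to `x` and few are moderately close, then `x` is covered. -/
theorem isCovered_of_ncard {k : ℕ} (hk1 : 1 ≤ k) (hk : k + 1 ≤ n) {x : V} {y : Fin n → V}
    {r : ℝ} (h1 : 0 < Set.ncard {i | y i ∈ Metric.closedBall x r})
    (h2 : Set.ncard {i | y i ∈ Metric.closedBall x (2 * r)} < k) : IsCovered k x y := by
  -- The ball around such a `y j` through `x` has radius at most `r`, hence lies in the ball of
  -- radius `2r` around `x`.
  obtain ⟨j, hj⟩ := (Set.ncard_pos (Set.toFinite _)).1 h1
  refine (isCovered_iff hk1 hk x y).2 ⟨j, lt_of_le_of_lt (Set.ncard_le_ncard ?_ (Set.toFinite _)) h2⟩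
  intro i hi
  have hj' : dist (y j) x ≤ r := hj
  have := dist_triangle (y i) (y j) x
  have := hi.2
  rw [dist_comm x] at this
  simp only [Set.mem_ofPred_eq, Metric.mem_closedBall]
  linarith

end Covered

/-! ### Probability of being covered at a fixed point -/

section Pointwise

/-- The unit vectors are less than 1 apart, so moving from `a` radially to length `‖b‖` and then
turning costs less than `‖a‖`. Hence the ball around a far point through the origin contains all
nonzero points of a narrow cone about its direction that are no farther out. -/
theorem norm_sub_lt_of_directions {V : Type*} [NormedAddCommGroup V] [NormedSpace ℝ V] {a b u : V}
    (hb : b ≠ 0) (hab : ‖b‖ ≤ ‖a‖) (hau : dist (‖a‖⁻¹ • a) u < 1 / 2)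
    (hbu : dist (‖b‖⁻¹ • b) u < 1 / 2) : ‖b - a‖ < ‖a‖ := by
  have hb0 : 0 < ‖b‖ := norm_pos_iff.2 hb
  have ha0 : 0 < ‖a‖ := hb0.trans_le hab
  have h1 : ‖‖b‖⁻¹ • b - ‖a‖⁻¹ • a‖ < 1 := by
    rw [← dist_eq_norm]
    linarith [dist_triangle_right (‖b‖⁻¹ • b) (‖a‖⁻¹ • a) u]
  have h2 : b - a = ‖b‖ • (‖b‖⁻¹ • b - ‖a‖⁻¹ • a) - (‖a‖ - ‖b‖) • (‖a‖⁻¹ • a) := by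
    rw [sub_smul, smul_sub, smul_inv_smul₀ hb0.ne', smul_inv_smul₀ ha0.ne']
    abel
  calc ‖b - a‖ ≤ ‖b‖ * ‖‖b‖⁻¹ • b - ‖a‖⁻¹ • a‖ + (‖a‖ - ‖b‖) := by
        rw [h2]
        refine (norm_sub_le _ _).trans (le_of_eq ?_)
        rw [norm_smul, norm_smul, norm_smul, norm_norm, norm_inv, norm_norm,
          inv_mul_cancel₀ ha0.ne', mul_one, Real.norm_of_nonneg (sub_nonneg.2 hab)]
    _ < ‖b‖ * 1 + (‖a‖ - ‖b‖) := by gcongr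
    _ = ‖a‖ := by ring

/-- For `x` outside the support, finitely many sets of positive measure suffice to lower bound the
mass of all balls around typical points `y` that have `x` on their boundary. -/
theorem exists_finite_family_subset_ball {V : Type*} [NormedAddCommGroup V] [NormedSpace ℝ V]
    [FiniteDimensional ℝ V] [MeasurableSpace V] [BorelSpace V] (ν : Measure V) {x : V}
    (hx : x ∉ ν.support) :
    ∃ T : Set (Set V), T.Finite ∧ (∀ A ∈ T, MeasurableSet A ∧ 0 < ν A) ∧
      ∀ᵐ y ∂ν, ∃ A ∈ T, A ⊆ Metric.ball y (dist x y) := by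
  have : ProperSpace V := FiniteDimensional.proper ℝ V
  obtain ⟨δ, hδ, hball⟩ := Metric.isOpen_iff.1 ν.isOpen_compl_support x hx
  have hdist : ∀ y ∈ ν.support, δ ≤ dist x y := by
    intro y hy
    by_contra! h
    rw [dist_comm] at h
    exact hball h hy
  obtain ⟨U, -, hUfin, hU⟩ :=
    (isCompact_sphere (0 : V) 1).finite_cover_balls (e := 1 / 2) (by norm_num)
  -- Finitely many cones with apex `x` handle distant centres, where compactness of the support is
  -- unavailable.
  set C : V → Set V := fun u => {y | y ≠ x ∧ dist (‖y - x‖⁻¹ • (y - x)) u < 1 / 2} with hC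
  have hCmeas : ∀ u, MeasurableSet (C u) := fun u => by
    have : Measurable fun y : V => dist (‖y - x‖⁻¹ • (y - x)) u := by fun_prop
    exact (measurableSet_singleton x).compl.inter (this measurableSet_Iio)
  have hM : ∀ u, ∃ M : ℕ, 0 < ν (C u) → 0 < ν (C u ∩ Metric.closedBall x M) := by
    intro u
    by_contra! h
    have h0 : ν (⋃ m : ℕ, C u ∩ Metric.closedBall x m) = 0 :=
      measure_iUnion_null fun m => le_antisymm (h m).2 zero_le
    rw [← Set.inter_iUnion, Metric.iUnion_closedBall_nat, Set.inter_univ] at h0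
    exact (h 0).1.ne' h0
  choose M hM using hM
  -- Centres beyond `R` are farther from `x` than every truncated cone reaches; centres within `R`
  -- form a compact part of the support.
  obtain ⟨R, hR⟩ : ∃ R : ℝ, ∀ u ∈ U, (M u : ℝ) ≤ R := by
    obtain ⟨R, hR⟩ := (hUfin.image fun u => (M u : ℝ)).bddAbove
    exact ⟨R, fun u hu => hR ⟨u, hu, rfl⟩⟩
  have hK : IsCompact (ν.support ∩ Metric.closedBall x R) :=
    (isCompact_closedBall x R).inter_left ν.isClosed_support
  obtain ⟨F, hFsub, hFfin, hF⟩ := hK.finite_cover_balls (e := δ / 2) (half_pos hδ)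
  refine ⟨(fun z => Metric.ball z (δ / 2)) '' F ∪
    (fun u => C u ∩ Metric.closedBall x (M u)) '' {u ∈ U | 0 < ν (C u)},
    (hFfin.image _).union ((hUfin.subset (Set.sep_subset _ _)).image _), ?_, ?_⟩
  · rintro A (⟨z, hz, rfl⟩ | ⟨u, hu, rfl⟩)
    · exact ⟨measurableSet_ball, (Measure.mem_support_iff_forall z).1 (hFsub hz).1 _
        (Metric.ball_mem_nhds z (half_pos hδ))⟩
    · exact ⟨(hCmeas u).inter measurableSet_closedBall, hM u hu.2⟩
  · have hnull : ∀ᵐ y ∂ν, ∀ u ∈ U, ν (C u) = 0 → y ∉ C u := by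
      rw [ae_ball_iff hUfin.countable]
      intro u _
      by_cases h : ν (C u) = 0
      · filter_upwards [measure_eq_zero_iff_ae_notMem.1 h] with y hy _ using hy
      · exact Eventually.of_forall fun y h' => absurd h' h
    filter_upwards [Measure.support_mem_ae (μ := ν), hnull] with y hy hyC
    have hyx : y ≠ x := fun h => hx (h ▸ hy)
    by_cases hyR : dist y x ≤ R
    · obtain ⟨z, hz, hyz⟩ := Set.mem_iUnion₂.1 (hF ⟨hy, hyR⟩)
      refine ⟨_, Or.inl ⟨z, hz, rfl⟩, fun w hw => ?_⟩
      have h1 := hdist y hy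
      have h2 := dist_triangle_right w y z
      simp only [Metric.mem_ball] at hw hyz ⊢
      linarith
    · have hy0 : y - x ≠ 0 := sub_ne_zero.2 hyx
      have hsph : ‖y - x‖⁻¹ • (y - x) ∈ Metric.sphere (0 : V) 1 := by
        simp [norm_smul, norm_ne_zero_iff.2 hy0]
      obtain ⟨u, hu, hyu⟩ := Set.mem_iUnion₂.1 (hU hsph)
      have hyCu : y ∈ C u := ⟨hyx, hyu⟩
      have hpos : 0 < ν (C u) := pos_iff_ne_zero.2 fun h => hyC u hu h hyCu
      refine ⟨_, Or.inr ⟨u, ⟨hu, hpos⟩, rfl⟩, fun z hz => ?_⟩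
      have hzM : dist z x ≤ M u := hz.2
      have hle : ‖z - x‖ ≤ ‖y - x‖ := by
        rw [← dist_eq_norm, ← dist_eq_norm]
        linarith [hR u hu]
      have := norm_sub_lt_of_directions (sub_ne_zero.2 hz.1.1) hle hyu hz.1.2
      rwa [sub_sub_sub_cancel_right, ← dist_eq_norm, ← dist_eq_norm, dist_comm y x] at this

variable {k : ℕ → ℕ}

/-- With `c = 1` this makes the `k`-th neighbour exist; with `c` half the mass of a set it puts `k`
below half the expected count there. -/
theorem eventually_succ_le (hk_n : Tendsto (fun n : ℕ => (k n : ℝ) / (n : ℝ)) atTop (𝓝 0)) {c : ℝ}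
    (hc : 0 < c) : ∀ᶠ n : ℕ in atTop, (k n : ℝ) + 1 ≤ n * c := by
  have h1 : Tendsto (fun n : ℕ => (k n : ℝ) / n + 1 / n) atTop (𝓝 0) := by
    simpa using hk_n.add tendsto_one_div_atTop_nhds_zero_nat
  filter_upwards [h1.eventually_le_const hc, eventually_gt_atTop 0] with n hn hn0
  have : (0 : ℝ) < n := Nat.cast_pos.2 hn0
  rw [← add_div, div_le_iff₀ this] at hn
  linarith

theorem tendsto_pi_isCovered_of_notMem_support {V : Type*} [NormedAddCommGroup V]
    [NormedSpace ℝ V] [FiniteDimensional ℝ V] [MeasurableSpace V] [BorelSpace V] (ν : Measure V)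
    [IsProbabilityMeasure ν] {x : V} (hx : x ∉ ν.support) (hk : Tendsto k atTop atTop)
    (hk_n : Tendsto (fun n : ℕ => (k n : ℝ) / (n : ℝ)) atTop (𝓝 0)) :
    Tendsto (fun n => (Measure.pi fun _ : Fin n => ν) {y | IsCovered (k n) x y}) atTop (𝓝 0) := by
  obtain ⟨T, hTfin, hT, hae⟩ := exists_finite_family_subset_ball ν hx
  have hpos : ∀ A ∈ T, 0 < ν.real A := fun A hA =>
    ENNReal.toReal_pos (hT A hA).2.ne' (measure_ne_top _ _)
  have hlim : Tendsto (fun n : ℕ => ∑ A ∈ hTfin.toFinset, ENNReal.ofReal (4 / (n * ν.real A)))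
      atTop (𝓝 0) := by
    rw [show (0 : ENNReal) = ∑ A ∈ hTfin.toFinset, ENNReal.ofReal 0 by simp]
    refine tendsto_finsetSum _ fun A hA => ENNReal.tendsto_ofReal ?_
    refine Tendsto.const_div_atTop ?_ 4
    exact tendsto_natCast_atTop_atTop.atTop_mul_const (hpos A (hTfin.mem_toFinset.1 hA))
  refine tendsto_of_tendsto_of_tendsto_of_le_of_le' tendsto_const_nhds hlim
    (Eventually.of_forall fun _ => zero_le) ?_
  have hlarge : ∀ᶠ n : ℕ in atTop, ∀ A ∈ T, (k n : ℝ) + 1 ≤ n * (ν.real A / 2) :=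
    (eventually_all_finite hTfin).2 fun A hA => eventually_succ_le hk_n (half_pos (hpos A hA))
  filter_upwards [hlarge, hk.eventually_ge_atTop 1, eventually_succ_le hk_n one_pos,
    eventually_gt_atTop 0] with n hn hk1 hkn hn0
  have hkn' : k n + 1 ≤ n := by
    rw [mul_one] at hkn
    exact_mod_cast hkn
  have hall : ∀ᵐ y ∂(Measure.pi fun _ : Fin n => ν), ∀ j,
      ∃ A ∈ T, A ⊆ Metric.ball (y j) (dist x (y j)) := by
    rw [ae_all_iff]
    exact fun j => (Measure.quasiMeasurePreserving_eval (fun _ : Fin n => ν) j).ae hae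
  calc (Measure.pi fun _ : Fin n => ν) {y | IsCovered (k n) x y}
      ≤ (Measure.pi fun _ : Fin n => ν) (⋃ A ∈ hTfin.toFinset,
          {y | (Set.ncard {i | y i ∈ A} : ℝ) ≤ n * ν.real A / 2}) := by
        refine measure_mono_ae ?_
        filter_upwards [hall] with y hy hcov
        obtain ⟨A, hA, hle⟩ := exists_ncard_le_of_isCovered hk1 hkn' hcov hy
        refine Set.mem_iUnion₂.2 ⟨A, hTfin.mem_toFinset.2 hA, ?_⟩
        have h1 := hn A hA
        have h2 : (Set.ncard {i | y i ∈ A} : ℝ) ≤ k n := by exact_mod_cast hle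
        simp only [Set.mem_ofPred_eq]
        linarith
    _ ≤ ∑ A ∈ hTfin.toFinset, (Measure.pi fun _ : Fin n => ν)
          {y | (Set.ncard {i | y i ∈ A} : ℝ) ≤ n * ν.real A / 2} := measure_biUnion_finset_le _ _
    _ ≤ _ := Finset.sum_le_sum fun A hA => by
        have hA' := hTfin.mem_toFinset.1 hA
        exact pi_ncard_le_half ν n (hT A hA').1 (mul_pos (Nat.cast_pos.2 hn0) (hpos A hA'))

/-- If the mass of small balls around `x` is comparable to `r ^ d`, then `x` is covered with
probability tending to one. -/
theorem tendsto_pi_not_isCovered {V : Type*} [PseudoMetricSpace V] [MeasurableSpace V]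
    [OpensMeasurableSpace V] (ν : Measure V) [IsProbabilityMeasure ν] {x : V} {d : ℕ} (hd : d ≠ 0)
    {c C : ℝ} (hc : 0 < c) (hC : 0 < C)
    (hball : ∀ᶠ r in 𝓝[>] (0 : ℝ), c * r ^ d ≤ ν.real (Metric.closedBall x r) ∧
      ν.real (Metric.closedBall x r) ≤ C * r ^ d)
    (hk : Tendsto k atTop atTop)
    (hk_n : Tendsto (fun n : ℕ => (k n : ℝ) / (n : ℝ)) atTop (𝓝 0)) :
    Tendsto (fun n => (Measure.pi fun _ : Fin n => ν) {y | ¬ IsCovered (k n) x y}) atTop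
      (𝓝 0) := by
  -- Solves `n * C * (2 * ρ) ^ d = k / 2` with `s = ρ ^ d`; the lower bound then gives the ball of
  -- radius `ρ` at least `k * e` expected points.
  set s : ℕ → ℝ := fun n => (k n : ℝ) / n / (2 * C * 2 ^ d) with hs
  set ρ : ℕ → ℝ := fun n => s n ^ (d : ℝ)⁻¹ with hρ
  have hs0 : Tendsto s atTop (𝓝 0) := by simpa using hk_n.div_const (2 * C * 2 ^ d)
  have hd' : (0 : ℝ) < (d : ℝ)⁻¹ := inv_pos.2 (Nat.cast_pos.2 (Nat.pos_of_ne_zero hd))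
  have hspos : ∀ᶠ n in atTop, 0 < s n := by
    filter_upwards [hk.eventually_ge_atTop 1, eventually_gt_atTop 0] with n h1 h2
    have : (0 : ℝ) < k n := Nat.cast_pos.2 h1
    have : (0 : ℝ) < n := Nat.cast_pos.2 h2
    positivity
  have hρ0 : Tendsto ρ atTop (𝓝[>] 0) := by
    refine tendsto_nhdsWithin_iff.2 ⟨?_, hspos.mono fun n hn => Real.rpow_pos_of_pos hn _⟩
    have := hs0.rpow_const (p := (d : ℝ)⁻¹) (Or.inr hd'.le)
    rwa [Real.zero_rpow hd'.ne'] at this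
  have hρ2 : Tendsto (fun n => 2 * ρ n) atTop (𝓝[>] 0) := by
    rw [tendsto_nhdsWithin_iff] at hρ0 ⊢
    exact ⟨by simpa using hρ0.1.const_mul 2, hρ0.2.mono fun n hn => by
      simp only [Set.mem_Ioi] at hn ⊢; linarith⟩
  have hkR : Tendsto (fun n => (k n : ℝ)) atTop atTop := tendsto_natCast_atTop_atTop.comp hk
  set e : ℝ := c / (2 * C * 2 ^ d) with he
  have he0 : 0 < e := by positivity
  have hlim : Tendsto (fun n : ℕ => ENNReal.ofReal (4 / (k n * e)) + ENNReal.ofReal (2 / k n))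
      atTop (𝓝 0) := by
    rw [show (0 : ENNReal) = ENNReal.ofReal 0 + ENNReal.ofReal 0 by simp]
    exact (ENNReal.tendsto_ofReal ((hkR.atTop_mul_const he0).const_div_atTop 4)).add
      (ENNReal.tendsto_ofReal (hkR.const_div_atTop 2))
  refine tendsto_of_tendsto_of_tendsto_of_le_of_le' tendsto_const_nhds hlim
    (Eventually.of_forall fun _ => zero_le) ?_
  filter_upwards [hρ0.eventually hball, hρ2.eventually hball, hspos,
    hk.eventually_ge_atTop 1, eventually_succ_le hk_n one_pos, eventually_gt_atTop 0]
    with n h1 h2 hsn hk1 hkn hn0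
  have hkn' : k n + 1 ≤ n := by
    rw [mul_one] at hkn
    exact_mod_cast hkn
  have hn : (0 : ℝ) < n := Nat.cast_pos.2 hn0
  have hkp : (0 : ℝ) < k n := Nat.cast_pos.2 hk1
  have hpow : ρ n ^ d = s n := Real.rpow_inv_natCast_pow hsn.le hd
  have hlow : k n * e ≤ n * ν.real (Metric.closedBall x (ρ n)) := by
    have := mul_le_mul_of_nonneg_left h1.1 hn.le
    rw [hpow] at this
    refine le_trans (le_of_eq ?_) this
    simp only [hs, he]
    field_simp
  have hup : n * ν.real (Metric.closedBall x (2 * ρ n)) ≤ k n / 2 := by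
    have := mul_le_mul_of_nonneg_left h2.2 hn.le
    rw [mul_pow, hpow] at this
    refine this.trans (le_of_eq ?_)
    simp only [hs]
    field_simp
  have hpos : 0 < n * ν.real (Metric.closedBall x (ρ n)) := lt_of_lt_of_le (by positivity) hlow
  calc (Measure.pi fun _ : Fin n => ν) {y | ¬ IsCovered (k n) x y}
      ≤ (Measure.pi fun _ : Fin n => ν)
          ({y | (Set.ncard {i | y i ∈ Metric.closedBall x (ρ n)} : ℝ) ≤
              n * ν.real (Metric.closedBall x (ρ n)) / 2} ∪
            {y | (k n : ℝ) ≤ (Set.ncard {i | y i ∈ Metric.closedBall x (2 * ρ n)} : ℝ)}) := by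
        refine measure_mono fun y hy => ?_
        by_contra! h
        simp only [Set.mem_union, Set.mem_ofPred_eq, not_or, not_le] at h
        refine hy (isCovered_of_ncard hk1 hkn' (r := ρ n) ?_ (by exact_mod_cast h.2))
        exact_mod_cast (half_pos hpos).trans h.1
    _ ≤ _ := measure_union_le _ _
    _ ≤ _ := add_le_add
        ((pi_ncard_le_half ν n measurableSet_closedBall hpos).trans
          (ENNReal.ofReal_le_ofReal (by gcongr)))
        (pi_le_ncard ν n measurableSet_closedBall hkp hup)

end Pointwise

/-! ### Maximal precision -/

section MaxPrecision

theorem exists_residual {V : Type*} [MeasurableSpace V] {ν κ : Measure V} [IsProbabilityMeasure ν]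
    [IsProbabilityMeasure κ] {β : ℝ} (hβ0 : 0 ≤ β) (hβ1 : β ≤ 1)
    (hle : ENNReal.ofReal β • κ ≤ ν) :
    ∃ ν' : Measure V, IsProbabilityMeasure ν' ∧
      ν = ENNReal.ofReal β • κ + ENNReal.ofReal (1 - β) • ν' := by
  have hfin : IsFiniteMeasure (ENNReal.ofReal β • κ) := isFiniteMeasure_of_le ν hle
  set τ := ν - ENNReal.ofReal β • κ with hτ
  have hadd : τ + ENNReal.ofReal β • κ = ν := Measure.sub_add_cancel_of_le hle
  have hmass : τ Set.univ = ENNReal.ofReal (1 - β) := by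
    rw [hτ, Measure.sub_apply MeasurableSet.univ hle]
    simp [ENNReal.ofReal_sub _ hβ0]
  rcases hβ1.eq_or_lt with rfl | hlt
  -- The residual has weight zero, so any probability measure serves.
  · have : τ = 0 := by simpa using hmass
    refine ⟨κ, inferInstance, ?_⟩
    rw [this] at hadd
    simpa using hadd.symm
  · have h0 : ENNReal.ofReal (1 - β) ≠ 0 := by simpa using hlt
    refine ⟨(ENNReal.ofReal (1 - β))⁻¹ • τ, ⟨?_⟩, ?_⟩
    · rw [Measure.smul_apply, hmass, smul_eq_mul, ENNReal.inv_mul_cancel h0 ENNReal.ofReal_ne_top]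
    · rw [smul_smul, ENNReal.mul_inv_cancel h0 ENNReal.ofReal_ne_top, one_smul, add_comm, hadd]

theorem IsAttainable.swap {V : Type*} [MeasurableSpace V] {μ ν : Measure V} {α β : ℝ}
    (h : IsAttainable μ ν α β) : IsAttainable ν μ β α := by
  obtain ⟨hα, hβ, κ, μ', ν', hκ, hμ', hν', h1, h2⟩ := h
  exact ⟨hβ, hα, κ, ν', μ', hκ, hν', hμ', h2, h1⟩

theorem IsMaxPrecision.isMaxRecall {V : Type*} [MeasurableSpace V] {μ ν : Measure V} {a : ℝ}
    (h : IsMaxPrecision μ ν a) : IsMaxRecall ν μ a := by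
  have : Prod.snd '' prSet ν μ = Prod.fst '' prSet μ ν := by
    ext a
    constructor
    · rintro ⟨p, hp | rfl, rfl⟩
      · exact ⟨p.swap, Or.inl hp.swap, rfl⟩
      · exact ⟨(0, 0), Or.inr rfl, rfl⟩
    · rintro ⟨p, hp | rfl, rfl⟩
      · exact ⟨p.swap, Or.inl hp.swap, rfl⟩
      · exact ⟨(0, 0), Or.inr rfl, rfl⟩
  rwa [IsMaxRecall, this]

theorem isMaxPrecision_of_restrict_support_le {V : Type*} [TopologicalSpace V]
    [HereditarilyLindelofSpace V] [MeasurableSpace V] [OpensMeasurableSpace V] {μ ν : Measure V}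
    [IsProbabilityMeasure μ] [IsProbabilityMeasure ν] {C : ℝ}
    (hC : μ.restrict ν.support ≤ ENNReal.ofReal C • ν) :
    IsMaxPrecision μ ν (μ.real ν.support) := by
  constructor
  · rcases (measureReal_nonneg (μ := μ) (s := ν.support)).eq_or_lt with h0 | hpos
    -- With no common mass, the maximum is supplied by the trivial pair.
    · exact ⟨(0, 0), Or.inr rfl, h0⟩
    set α := μ.real ν.support with hα
    have hα1 : α ≤ 1 := measureReal_le_one
    have hαμ : ENNReal.ofReal α = μ ν.support := ofReal_measureReal
    have hμ0 : μ ν.support ≠ 0 := by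
      rw [← hαμ]
      simpa using hpos
    -- Taking `D ≥ 1` keeps the recall `α / D` at most 1.
    set D := max C 1 with hD
    have hD1 : 1 ≤ D := le_max_right _ _
    have hD0 : 0 < D := one_pos.trans_le hD1
    set κ := (μ ν.support)⁻¹ • μ.restrict ν.support with hκ
    have hκp : IsProbabilityMeasure κ := ⟨by
      rw [hκ, Measure.smul_apply, Measure.restrict_apply_univ, smul_eq_mul,
        ENNReal.inv_mul_cancel hμ0 (measure_ne_top _ _)]⟩
    have hακ : ENNReal.ofReal α • κ = μ.restrict ν.support := by
      rw [hαμ, hκ, smul_smul, ENNReal.mul_inv_cancel hμ0 (measure_ne_top _ _), one_smul]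
    have hβ1 : α / D ≤ 1 := (div_le_one hD0).2 (hα1.trans hD1)
    have hβκ : ENNReal.ofReal (α / D) • κ ≤ ν := by
      rw [div_eq_inv_mul, ENNReal.ofReal_mul (inv_nonneg.2 hD0.le), mul_smul, hακ]
      calc ENNReal.ofReal D⁻¹ • μ.restrict ν.support
          ≤ ENNReal.ofReal D⁻¹ • ENNReal.ofReal D • ν := by
            refine Measure.le_iff.2 fun A hA => ?_
            have h1 := Measure.le_iff.1 hC A hA
            simp only [Measure.smul_apply, smul_eq_mul] at h1 ⊢
            gcongr
            refine h1.trans ?_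
            gcongr
            exact le_max_left _ _
        _ = ν := by
            rw [smul_smul, ← ENNReal.ofReal_mul (inv_nonneg.2 hD0.le), inv_mul_cancel₀ hD0.ne',
              ENNReal.ofReal_one, one_smul]
    obtain ⟨ν', hν', hν⟩ := exists_residual (by positivity) hβ1 hβκ
    obtain ⟨μ', hμ', hμ⟩ := exists_residual hpos.le hα1
      (hακ.le.trans Measure.restrict_le_self)
    exact ⟨(α, α / D), Or.inl ⟨⟨hpos, hα1⟩, ⟨by positivity, hβ1⟩, κ, μ', ν', hκp, hμ', hν', hν, hμ⟩,
      rfl⟩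
  · rintro _ ⟨⟨α, β⟩, h | h, rfl⟩
    · obtain ⟨hα, hβ, κ, μ', ν', hκ, hμ', hν', h1, h2⟩ := h
      have hνS : ν ν.supportᶜ = 0 := Measure.measure_compl_support
      have hκS : κ ν.supportᶜ = 0 := by
        have hle : ENNReal.ofReal β • κ ≤ ν := (Measure.le_add_right le_rfl).trans_eq h1.symm
        have : ENNReal.ofReal β * κ ν.supportᶜ ≤ ν ν.supportᶜ := hle _
        rw [hνS, nonpos_iff_eq_zero, mul_eq_zero] at this
        exact this.resolve_left (by simpa using hβ.1)
      have hκ1 : κ ν.support = 1 :=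
        (prob_compl_eq_zero_iff Measure.isClosed_support.measurableSet).1 hκS
      have : ENNReal.ofReal α ≤ μ ν.support := by
        conv_rhs => rw [h2]
        simp [hκ1]
      exact (ENNReal.ofReal_le_iff_le_toReal (measure_ne_top _ _)).1 this
    · obtain ⟨rfl, rfl⟩ := Prod.mk.inj h
      exact measureReal_nonneg

end MaxPrecision

/-! ### Consequences of the density bounds -/

section Density

variable {d : ℕ} {μ ν : Measure (EuclideanSpace ℝ (Fin d))} {f g : EuclideanSpace ℝ (Fin d) → ℝ}
  {E : Set (EuclideanSpace ℝ (Fin d))}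

theorem HasDensityOn.ae_mem (hf : HasDensityOn μ f E) (hE : MeasurableSet E) :
    ∀ᵐ x ∂μ, x ∈ E := by
  have : μ ≪ volume.restrict E := by
    rw [hf.eq_withDensity]
    exact withDensity_absolutelyContinuous _ _
  exact this.ae_le (ae_restrict_mem hE)

/-- On both supports `f ≤ a₂ ≤ (a₂ / a₁) * g`. Off the support of `μ` the bound on `f` is not
assumed, but there `f` vanishes almost everywhere. -/
theorem HasDensityOn.restrict_support_le (hf : HasDensityOn μ f E) (hg : HasDensityOn ν g E)
    (hE : MeasurableSet E) {a₁ a₂ : ℝ} (ha₁ : 0 < a₁) (hfb : ∀ x ∈ E ∩ μ.support, f x ≤ a₂)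
    (hgb : ∀ x ∈ E ∩ ν.support, a₁ < g x) :
    μ.restrict ν.support ≤ ENNReal.ofReal (a₂ / a₁) • ν := by
  have hS : MeasurableSet ν.support := Measure.isClosed_support.measurableSet
  have hzero : ∀ᵐ x ∂volume.restrict E, x ∉ μ.support → ENNReal.ofReal (f x) = 0 := by
    have h0 : μ μ.supportᶜ = 0 := Measure.measure_compl_support
    rw [show μ μ.supportᶜ = (volume.restrict E).withDensity (fun x => ENNReal.ofReal (f x))
      μ.supportᶜ by rw [← hf.eq_withDensity],
      withDensity_apply_eq_zero' hf.aemeasurable.ennreal_ofReal] at h0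
    filter_upwards [measure_eq_zero_iff_ae_notMem.1 h0] with x hx hxS
    by_contra h
    exact hx ⟨h, hxS⟩
  have hle : (fun x => ENNReal.ofReal (f x)) ≤ᵐ[(volume.restrict E).restrict ν.support]
      ENNReal.ofReal (a₂ / a₁) • fun x => ENNReal.ofReal (g x) := by
    filter_upwards [ae_restrict_of_ae hzero, ae_restrict_of_ae (ae_restrict_mem hE),
      ae_restrict_mem hS] with x hx hxE hxS
    by_cases hxμ : x ∈ μ.support
    · have h1 := hfb x ⟨hxE, hxμ⟩
      have h2 := hgb x ⟨hxE, hxS⟩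
      have h3 : 0 ≤ a₂ / a₁ := div_nonneg ((hf.nonneg x hxE).trans h1) ha₁.le
      rw [Pi.smul_apply, smul_eq_mul, ← ENNReal.ofReal_mul h3]
      refine ENNReal.ofReal_le_ofReal (h1.trans ?_)
      calc a₂ = a₂ / a₁ * a₁ := by field_simp
        _ ≤ a₂ / a₁ * g x := by gcongr
    · rw [hx hxμ]
      exact zero_le
  calc μ.restrict ν.support
      = ((volume.restrict E).restrict ν.support).withDensity fun x => ENNReal.ofReal (f x) := by
        conv_lhs => rw [hf.eq_withDensity]
        exact restrict_withDensity hS _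
    _ ≤ ((volume.restrict E).restrict ν.support).withDensity
          (ENNReal.ofReal (a₂ / a₁) • fun x => ENNReal.ofReal (g x)) := withDensity_mono hle
    _ = ENNReal.ofReal (a₂ / a₁) • ν.restrict ν.support := by
        rw [withDensity_smul' _ _ ENNReal.ofReal_ne_top, ← restrict_withDensity hS,
          ← hg.eq_withDensity]
    _ ≤ ENNReal.ofReal (a₂ / a₁) • ν := by
        gcongr
        exact Measure.restrict_le_self

/-- Almost everywhere on the support, the mass of small balls is comparable to their volume. -/
theorem HasDensityOn.ae_ball_bounds [IsFiniteMeasure ν] (hg : HasDensityOn ν g E)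
    (hE : MeasurableSet E) (hgpos : ∀ x ∈ E ∩ ν.support, 0 < g x) :
    ∀ᵐ x ∂volume, x ∈ E → x ∈ ν.support → ∃ c C : ℝ, 0 < c ∧ 0 < C ∧
      ∀ᶠ r in 𝓝[>] (0 : ℝ), c * r ^ d ≤ ν.real (Metric.closedBall x r) ∧
        ν.real (Metric.closedBall x r) ≤ C * r ^ d := by
  have hrn : ν.rnDeriv volume =ᵐ[volume] E.indicator fun x => ENNReal.ofReal (g x) := by
    conv_lhs => rw [hg.eq_withDensity, ← withDensity_indicator hE]
    exact Measure.rnDeriv_withDensity₀ _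
      ((aemeasurable_indicator_iff hE).2 hg.aemeasurable.ennreal_ofReal)
  filter_upwards [hrn, Besicovitch.ae_tendsto_rnDeriv ν volume] with x hx hlim hxE hxS
  have hL := hgpos x ⟨hxE, hxS⟩
  rw [hx, Set.indicator_of_mem hxE] at hlim
  have hlim' := (ENNReal.tendsto_toReal ENNReal.ofReal_ne_top).comp hlim
  rw [ENNReal.toReal_ofReal hL.le] at hlim'
  set ω := (volume : Measure (EuclideanSpace ℝ (Fin d))).real (Metric.closedBall 0 1) with hω
  have hω0 : 0 < ω := ENNReal.toReal_pos
    (Metric.measure_closedBall_pos _ _ one_pos).ne' measure_closedBall_lt_top.ne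
  -- The ratio of `ν`-mass to volume tends to `g x > 0`, so it is eventually within a factor 2 of
  -- it; `ω` is the volume of the unit ball.
  refine ⟨g x / 2 * ω, 2 * g x * ω, by positivity, by positivity, ?_⟩
  filter_upwards [hlim'.eventually_const_le (half_lt_self hL),
    hlim'.eventually_le_const (show g x < 2 * g x by linarith), self_mem_nhdsWithin]
    with r h1 h2 hr
  have hr0 : (0 : ℝ) < r := hr
  have hvol : (volume (Metric.closedBall x r)).toReal = r ^ d * ω := by
    have := Measure.addHaar_real_closedBall' (volume : Measure (EuclideanSpace ℝ (Fin d))) x hr0.le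
    rwa [finrank_euclideanSpace_fin] at this
  have hpos : 0 < r ^ d * ω := by positivity
  simp only [Function.comp_apply, ENNReal.toReal_div, hvol] at h1 h2
  rw [le_div_iff₀ hpos] at h1
  rw [div_le_iff₀ hpos] at h2
  simp only [Measure.real]
  constructor <;> linarith

end Density

/-! ### Convergence of the improved precision -/

section Convergence

theorem improvedPrecision_eq {V : Type*} [PseudoMetricSpace V] {n : ℕ} (k : ℕ)
    (x y : Fin n → V) :
    improvedPrecision k x y = (Set.ncard {i | IsCovered k (x i) y} : ℝ) / n := by
  classical
  have h : {i | IsCovered k (x i) y} = ↑(Finset.univ.filter fun i => IsCovered k (x i) y) := by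
    simp
  rw [h, Set.ncard_coe_finset, improvedPrecision, one_div_mul_eq_div, Finset.sum_boole]
  congr 3
  ext i
  rw [Finset.mem_filter, Finset.mem_filter]
  rfl

/-- The fractions of indices satisfying two predicates differ at most by the fraction of indices
on which the predicates disagree. -/
theorem abs_ncard_sub_ncard_le {n : ℕ} (A B : Set (Fin n)) :
    |(Set.ncard A : ℝ) - Set.ncard B| ≤ Set.ncard {i | ¬ (i ∈ A ↔ i ∈ B)} := by
  have h1 : Set.ncard A ≤ Set.ncard B + Set.ncard {i | ¬ (i ∈ A ↔ i ∈ B)} := by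
    refine (Set.ncard_le_ncard ?_ (Set.toFinite _)).trans (Set.ncard_union_le _ _)
    intro i hi
    by_cases hB : i ∈ B
    · exact Or.inl hB
    · exact Or.inr fun h => hB (h.1 hi)
  have h2 : Set.ncard B ≤ Set.ncard A + Set.ncard {i | ¬ (i ∈ A ↔ i ∈ B)} := by
    refine (Set.ncard_le_ncard ?_ (Set.toFinite _)).trans (Set.ncard_union_le _ _)
    intro i hi
    by_cases hA : i ∈ A
    · exact Or.inl hA
    · exact Or.inr fun h => hA (h.2 hi)
  rw [abs_le]
  have h1' : (Set.ncard A : ℝ) ≤ Set.ncard B + Set.ncard {i | ¬ (i ∈ A ↔ i ∈ B)} := by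
    exact_mod_cast h1
  have h2' : (Set.ncard B : ℝ) ≤ Set.ncard A + Set.ncard {i | ¬ (i ∈ A ↔ i ∈ B)} := by
    exact_mod_cast h2
  constructor <;> linarith

variable {V : Type*} [MeasurableSpace V] {Ω : Type*} [MeasurableSpace Ω] {P : Measure Ω}

/-- Markov's inequality for the fraction of sample points that are in bad position relative to an
independent random variable. -/
theorem le_ncard_div_le_prod {W : Type*} [MeasurableSpace W] [IsProbabilityMeasure P]
    {μ : Measure V} [IsProbabilityMeasure μ] {ν : Measure W} [IsProbabilityMeasure ν] {n : ℕ}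
    (hn : 0 < n) {X : Ω → Fin n → V} {Y : Ω → W}
    (hX : HasLaw X (Measure.pi fun _ : Fin n => μ) P) (hY : HasLaw Y ν P) (hXY : IndepFun X Y P)
    {B : Set (V × W)} (hB : MeasurableSet B) {ε : ℝ} (hε : 0 < ε) :
    P {ω | ε ≤ (Set.ncard {i | (X ω i, Y ω) ∈ B} : ℝ) / n} ≤
      (μ.prod ν) B / ENNReal.ofReal ε := by
  classical
  -- Expectation is linear, so only the law of each single pair matters; the dependence between
  -- pairs through the common `Y` is harmless.
  have hpair : ∀ i, HasLaw (fun ω => (X ω i, Y ω)) (μ.prod ν) P := by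
    intro i
    have hXi : HasLaw (fun ω => X ω i) μ P :=
      ⟨(measurable_pi_apply i).comp_aemeasurable hX.aemeasurable, by
        rw [← (measurePreserving_eval (fun _ : Fin n => μ) i).map_eq, ← hX.map_eq,
          AEMeasurable.map_map_of_aemeasurable (measurable_pi_apply i).aemeasurable hX.aemeasurable]
        rfl⟩
    refine ⟨hXi.aemeasurable.prodMk hY.aemeasurable, ?_⟩
    have hind : IndepFun (fun ω => X ω i) Y P :=
      hXY.comp (φ := fun x : Fin n → V => x i) (ψ := id) (measurable_pi_apply i) measurable_id
    rw [(indepFun_iff_map_prod_eq_prod_map_map hXi.aemeasurable hY.aemeasurable).1 hind,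
      hXi.map_eq, hY.map_eq]
  set F : Fin n → Ω → ENNReal := fun i ω => B.indicator (fun _ => 1) (X ω i, Y ω) with hF
  have hFm : ∀ i, AEMeasurable (F i) P := fun i =>
    (measurable_const.indicator hB).comp_aemeasurable (hpair i).aemeasurable
  have hFint : ∀ i, ∫⁻ ω, F i ω ∂P = (μ.prod ν) B := by
    intro i
    rw [← lintegral_indicator_one hB, ← (hpair i).map_eq,
      lintegral_map' (measurable_one.indicator hB).aemeasurable (hpair i).aemeasurable]
    rfl
  have hsum : ∀ ω, ∑ i, F i ω = ENNReal.ofReal (Set.ncard {i | (X ω i, Y ω) ∈ B} : ℝ) := by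
    intro ω
    rw [Set.ncard_eq_toFinset_card']
    simp [hF, Set.indicator, Finset.sum_boole]
  have hnR : (0 : ℝ) < n := Nat.cast_pos.2 hn
  have hn0 : ENNReal.ofReal n ≠ 0 := by simpa using hn.ne'
  have hε0 : ENNReal.ofReal ε ≠ 0 := by simpa using hε
  have hset : {ω | ε ≤ (Set.ncard {i | (X ω i, Y ω) ∈ B} : ℝ) / n} ⊆
      {ω | ENNReal.ofReal ε * ENNReal.ofReal n ≤ ∑ i, F i ω} := by
    intro ω hω
    simp only [Set.mem_ofPred_eq] at hω ⊢
    rw [hsum, ← ENNReal.ofReal_mul hε.le]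
    exact ENNReal.ofReal_le_ofReal ((le_div_iff₀ hnR).1 hω)
  have hmarkov := meas_ge_le_lintegral_div
    (Finset.aemeasurable_fun_sum Finset.univ fun i _ => hFm i)
    (mul_ne_zero hε0 hn0) (ENNReal.mul_ne_top ENNReal.ofReal_ne_top ENNReal.ofReal_ne_top)
  refine (measure_mono hset).trans (hmarkov.trans (le_of_eq ?_))
  rw [lintegral_finsetSum' _ fun i _ => hFm i]
  simp only [hFint, Finset.sum_const, Finset.card_univ, Fintype.card_fin, nsmul_eq_mul,
    ENNReal.ofReal_natCast]
  rw [mul_comm (ENNReal.ofReal ε), ENNReal.mul_div_mul_left _ _ (by simpa using hn.ne') (by simp)]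

/-- The improved precision converges in probability to the mass of the support as soon as almost
every point is covered with probability tending to one on the support and to zero off it. -/
theorem tendstoInMeasure_improvedPrecision [PseudoMetricSpace V] [OpensMeasurableSpace V]
    [SecondCountableTopology V] [IsProbabilityMeasure P] {μ ν : Measure V}
    [IsProbabilityMeasure μ] [IsProbabilityMeasure ν] {k : ℕ → ℕ} {S : Set V}
    (hS : MeasurableSet S)
    (hcov : ∀ᵐ x ∂μ, Tendsto (fun n => (Measure.pi fun _ : Fin n => ν)
      {y | ¬ (IsCovered (k n) x y ↔ x ∈ S)}) atTop (𝓝 0))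
    (hk : Tendsto k atTop atTop)
    (hk_n : Tendsto (fun n : ℕ => (k n : ℝ) / (n : ℝ)) atTop (𝓝 0))
    {X Y : (n : ℕ) → Ω → Fin n → V}
    (hX : ∀ n, HasLaw (X n) (Measure.pi fun _ : Fin n => μ) P)
    (hY : ∀ n, HasLaw (Y n) (Measure.pi fun _ : Fin n => ν) P)
    (hXY : ∀ n, IndepFun (X n) (Y n) P) :
    TendstoInMeasure P (fun n ω => improvedPrecision (k n) (X n ω) (Y n ω)) atTop
      (fun _ => μ.real S) := by
  set B : (n : ℕ) → Set (V × (Fin n → V)) := fun n =>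
    {p | ¬ (IsCovered (k n) p.1 p.2 ↔ p.1 ∈ S)} with hB
  have hgood : ∀ᶠ n : ℕ in atTop, 1 ≤ k n ∧ k n + 1 ≤ n := by
    filter_upwards [hk.eventually_ge_atTop 1, eventually_succ_le hk_n one_pos] with n h1 h2
    rw [mul_one] at h2
    exact ⟨h1, by exact_mod_cast h2⟩
  have hBmeas : ∀ᶠ n in atTop, MeasurableSet (B n) := by
    filter_upwards [hgood] with n hn
    have h1 : MeasurableSet {p : V × (Fin n → V) | IsCovered (k n) p.1 p.2} :=
      measurableSet_isCovered hn.1 hn.2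
    have h2 : MeasurableSet {p : V × (Fin n → V) | p.1 ∈ S} := measurable_fst hS
    exact (h1.iff h2).compl
  have hBlim : Tendsto (fun n => (μ.prod (Measure.pi fun _ : Fin n => ν)) (B n)) atTop (𝓝 0) := by
    have hlim : Tendsto (fun n => ∫⁻ x, (Measure.pi fun _ : Fin n => ν)
        {y | ¬ (IsCovered (k n) x y ↔ x ∈ S)} ∂μ) atTop (𝓝 (∫⁻ _, 0 ∂μ)) := by
      refine tendsto_lintegral_filter_of_dominated_convergence (fun _ => 1) ?_ ?_ (by simp) hcov
      · filter_upwards [hBmeas] with n hn using measurable_measure_prodMk_left hn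
      · exact Eventually.of_forall fun n => Eventually.of_forall fun x => prob_le_one
    rw [lintegral_zero] at hlim
    refine hlim.congr' ?_
    filter_upwards [hBmeas] with n hn
    rw [Measure.prod_apply hn]
    rfl
  rw [tendstoInMeasure_iff_norm]
  intro ε hε
  have hε2 := half_pos hε
  -- Half of `ε` pays for points whose coverage disagrees with membership in `S`, half for the
  -- fluctuation of the number of points in `S`.
  have hlim : Tendsto (fun n : ℕ => (μ.prod (Measure.pi fun _ : Fin n => ν)) (B n) /
      ENNReal.ofReal (ε / 2) + ENNReal.ofReal (μ.real S / (ε / 2) ^ 2 / n)) atTop (𝓝 0) := by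
    rw [show (0 : ENNReal) = 0 / ENNReal.ofReal (ε / 2) + ENNReal.ofReal 0 by simp]
    refine (ENNReal.Tendsto.div_const hBlim (Or.inr (by simpa using hε))).add
      (ENNReal.tendsto_ofReal ?_)
    exact tendsto_natCast_atTop_atTop.const_div_atTop _
  refine tendsto_of_tendsto_of_tendsto_of_le_of_le' tendsto_const_nhds hlim
    (Eventually.of_forall fun _ => zero_le) ?_
  filter_upwards [hBmeas, eventually_gt_atTop 0] with n hBn hn
  have hnR : (0 : ℝ) < n := Nat.cast_pos.2 hn
  have hcount : P {ω | ε / 2 * n ≤ |(Set.ncard {i | X n ω i ∈ S} : ℝ) - n * μ.real S|} ≤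
      ENNReal.ofReal (μ.real S / (ε / 2) ^ 2 / n) := by
    have h1 := pi_le_abs_ncard_sub μ n hS (mul_pos hε2 hnR)
    have hmeas : MeasurableSet {x : Fin n → V |
        ε / 2 * n ≤ |(Set.ncard {i | x i ∈ S} : ℝ) - n * μ.real S|} :=
      measurableSet_le measurable_const
        (continuous_abs.measurable.comp ((measurable_ncard_mem hS).sub_const _))
    rw [← (hX n).map_eq, Measure.map_apply_of_aemeasurable (hX n).aemeasurable hmeas] at h1
    refine h1.trans_eq ?_
    congr 1
    field_simp
  refine le_trans (measure_mono ?_) ((measure_union_le _ _).trans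
    (add_le_add (le_ncard_div_le_prod hn (hX n) (hY n) (hXY n) hBn hε2) hcount))
  intro ω hω
  by_contra! h
  simp only [Set.mem_union, Set.mem_ofPred_eq, not_or, not_le] at h hω
  obtain ⟨h1, h2⟩ := h
  rw [div_lt_iff₀ hnR] at h1
  have h3 := abs_ncard_sub_ncard_le {i | IsCovered (k n) (X n ω i) (Y n ω)} {i | X n ω i ∈ S}
  have h4 : |(Set.ncard {i | IsCovered (k n) (X n ω i) (Y n ω)} : ℝ) - n * μ.real S| < ε * n := by
    refine (abs_sub_le _ (Set.ncard {i | X n ω i ∈ S} : ℝ) _).trans_lt ?_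
    have h5 : (Set.ncard {i | ¬ (i ∈ {i | IsCovered (k n) (X n ω i) (Y n ω)} ↔
      i ∈ {i | X n ω i ∈ S})} : ℝ) < ε / 2 * n := h1
    linarith
  rw [improvedPrecision_eq, Real.norm_eq_abs] at hω
  have h6 : (Set.ncard {i | IsCovered (k n) (X n ω i) (Y n ω)} : ℝ) / n - μ.real S =
      ((Set.ncard {i | IsCovered (k n) (X n ω i) (Y n ω)} : ℝ) - n * μ.real S) / n := by
    field_simp
  rw [h6, abs_div, abs_of_pos hnR, le_div_iff₀ hnR] at hω
  linarith

end Convergence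

/-! ### Coverage under the density hypotheses -/

section Main

variable {d : ℕ} {μ ν : Measure (EuclideanSpace ℝ (Fin d))} {f g : EuclideanSpace ℝ (Fin d) → ℝ}
  {E : Set (EuclideanSpace ℝ (Fin d))}

theorem HasDensityOn.ae_tendsto_pi_isCovered [IsProbabilityMeasure ν] (hf : HasDensityOn μ f E)
    (hg : HasDensityOn ν g E) (hE : MeasurableSet E) (hgpos : ∀ x ∈ E ∩ ν.support, 0 < g x)
    {k : ℕ → ℕ} (hk : Tendsto k atTop atTop)
    (hk_n : Tendsto (fun n : ℕ => (k n : ℝ) / (n : ℝ)) atTop (𝓝 0)) :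
    ∀ᵐ x ∂μ, Tendsto (fun n => (Measure.pi fun _ : Fin n => ν)
      {y | ¬ (IsCovered (k n) x y ↔ x ∈ ν.support)}) atTop (𝓝 0) := by
  have hac : μ ≪ volume := by
    rw [hf.eq_withDensity]
    exact (withDensity_absolutelyContinuous _ _).trans Measure.restrict_le_self.absolutelyContinuous
  filter_upwards [hf.ae_mem hE, hac.ae_le (hg.ae_ball_bounds hE hgpos)] with x hxE hx
  by_cases hxS : x ∈ ν.support
  · simp only [hxS, iff_true]
    -- In dimension zero ball mass does not shrink with the radius, but the space is a single point,
    -- covered by any data point.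
    rcases eq_or_ne d 0 with rfl | hd
    · refine tendsto_const_nhds.congr' ?_
      filter_upwards [eventually_gt_atTop 0] with n hn
      have hcov : ∀ y : Fin n → EuclideanSpace ℝ (Fin 0), IsCovered (k n) x y := fun y =>
        ⟨⟨0, hn⟩, by
          rw [Subsingleton.elim x (y ⟨0, hn⟩), dist_self]
          exact kthNeighborDist_nonneg _ _ _⟩
      simp [hcov]
    · obtain ⟨c, C, hc, hC, hball⟩ := hx hxE hxS
      exact tendsto_pi_not_isCovered ν hd hc hC hball hk hk_n
  · simp only [hxS, iff_false, not_not]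
    exact tendsto_pi_isCovered_of_notMem_support ν hxS hk hk_n

/-- Coverage is studied at a fixed `x`, with Chebyshev errors of order `1 / k` or `1 / n`, so
divergence of `k` is the form of the growth condition that is needed. -/
theorem tendsto_atTop_of_div_log {k : ℕ → ℕ}
    (h : Tendsto (fun n : ℕ => (k n : ℝ) / Real.log (n : ℝ)) atTop atTop) :
    Tendsto k atTop atTop := by
  have hlog : Tendsto (fun n : ℕ => Real.log (n : ℝ)) atTop atTop :=
    Real.tendsto_log_atTop.comp tendsto_natCast_atTop_atTop
  rw [← tendsto_natCast_atTop_iff (R := ℝ)]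
  refine (h.atTop_mul_atTop₀ hlog).congr' ?_
  filter_upwards [hlog.eventually_gt_atTop 0] with n hn
  exact div_mul_cancel₀ _ hn.ne'

end Main

end ImprovedPR

end

theorem theorem1 {d : ℕ} (E : Set (EuclideanSpace ℝ (Fin d))) (hE : MeasurableSet E)
    (μ ν : Measure (EuclideanSpace ℝ (Fin d))) [IsProbabilityMeasure μ] [IsProbabilityMeasure ν]
    (f g : EuclideanSpace ℝ (Fin d) → ℝ)
    (hf : ImprovedPR.HasDensityOn μ f E) (hg : ImprovedPR.HasDensityOn ν g E)
    (hfc : UniformContinuousOn f (E ∩ μ.support)) (hgc : UniformContinuousOn g (E ∩ ν.support))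
    (a₁ a₂ : ℝ) (ha₁ : 0 < a₁)
    (hfb : ∀ x ∈ E ∩ μ.support, a₁ < f x ∧ f x ≤ a₂)
    (hgb : ∀ x ∈ E ∩ ν.support, a₁ < g x ∧ g x ≤ a₂)
    (k : ℕ → ℕ)
    (hk_log : Tendsto (fun n : ℕ => (k n : ℝ) / Real.log (n : ℝ)) atTop atTop)
    (hk_n : Tendsto (fun n : ℕ => (k n : ℝ) / (n : ℝ)) atTop (𝓝 0))
    {Ω : Type*} [MeasurableSpace Ω] (P : Measure Ω) [IsProbabilityMeasure P]
    (X Y : (n : ℕ) → Ω → Fin n → EuclideanSpace ℝ (Fin d))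
    (hX : ∀ n, HasLaw (X n) (Measure.pi fun _ : Fin n => μ) P)
    (hY : ∀ n, HasLaw (Y n) (Measure.pi fun _ : Fin n => ν) P)
    (hXY : ∀ n, IndepFun (X n) (Y n) P) :
    ∃ αbar βbar : ℝ,
      ImprovedPR.IsMaxPrecision μ ν αbar ∧ ImprovedPR.IsMaxRecall μ ν βbar ∧
      αbar = μ.real ν.support ∧ βbar = ν.real μ.support ∧
      TendstoInMeasure P (fun n ω => ImprovedPR.improvedPrecision (k n) (X n ω) (Y n ω)) atTop
        (fun _ => αbar) ∧
      TendstoInMeasure P (fun n ω => ImprovedPR.improvedRecall (k n) (X n ω) (Y n ω)) atTop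
        (fun _ => βbar) := by
  have hk := ImprovedPR.tendsto_atTop_of_div_log hk_log
  refine ⟨_, _, ImprovedPR.isMaxPrecision_of_restrict_support_le (hf.restrict_support_le hg hE ha₁
    (fun x hx => (hfb x hx).2) fun x hx => (hgb x hx).1),
    (ImprovedPR.isMaxPrecision_of_restrict_support_le (hg.restrict_support_le hf hE ha₁
    (fun x hx => (hgb x hx).2) fun x hx => (hfb x hx).1)).isMaxRecall, rfl, rfl, ?_, ?_⟩
  · exact ImprovedPR.tendstoInMeasure_improvedPrecision Measure.isClosed_support.measurableSet
      (hf.ae_tendsto_pi_isCovered hg hE (fun x hx => ha₁.trans (hgb x hx).1) hk hk_n)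
      hk hk_n hX hY hXY
  -- Recall is by definition precision with the two samples exchanged.
  · exact ImprovedPR.tendstoInMeasure_improvedPrecision Measure.isClosed_support.measurableSet
      (hg.ae_tendsto_pi_isCovered hf hE (fun x hx => ha₁.trans (hfb x hx).1) hk hk_n)
      hk hk_n hY hX fun n => (hXY n).symm
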